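/- Let $\mathbb T^4=\mathbb R^4/\mathbb Z^4$ with coordinates $x^1,\dots,x^4$ and let $(g_0,J_0,\omega_0)$ be the standard flat Kähler structure, $g_0=\sum_i dx^i\otimes dx^i$, $\omega_0=dx^1\wedge dx^2+dx^3\wedge dx^4$, $$J_0dx^1=dx^2,\quad J_0dx^2=-dx^1,\quad J_0dx^3=dx^4,\quad J_0dx^4=-dx^3,$$ where an almost complex structure $J$ acts on $1$-forms by $(J\alpha)(X)=-\alpha(JX)$. For an almost complex structure $J$ on $\mathbb T^4$ let $H_J^{\pm}\subset H^2(\mathbb T^4;\mathbb R)$ be the subspace of de Rham classes represented by a closed smooth $2$-form $\alpha$ with $\alpha(J\cdot,J\cdot)=\pm\alpha$, and let $h_J^{\pm}=\dim H_J^{\pm}$. An almost complex structure $J$ is called $\omega_0$-compatible if $\omega_0(X,JX)>0$ for all $X\neq0$ and $\omega_0(JX,JY)=\omega_0(X,Y)$ for all $X,Y$. For integers $k\ge 1$ set $$A_k=e^{\frac1k\sin 2\pi(x^1+x^3)},\quad B_k=e^{\frac1k\sin 2\pi(x^1+x^4)},\quad C_k=\Big(\frac{A_k}{B_k}\Big)^{1/2},\quad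 D_k=\Big(\frac1{A_kB_k}\Big)^{1/2},$$ and let $J_k$ be the almost complex structure with $$J_kdx^1=C_kdx^2,\quad J_kdx^2=-\tfrac1{C_k}dx^1,\quad J_kdx^3=D_kdx^4,\quad J_kdx^4=-\tfrac1{D_k}dx^3,$$ and $g_k(\cdot,\cdot)=\omega_0(\cdot,J_k\cdot)$. Theorem. The form $\omega_0$ is closed, $J_0$ is $\omega_0$-compatible and $g_0=\omega_0(\cdot,J_0\cdot)$; every $J_k$ is $\omega_0$-compatible. As $k\to\infty$, $J_k\to J_0$ and $g_k\to g_0$ in the $C^\infty$-topology. However, $h^-_{J_k}=0$ and $h^+_{J_k}=6$ for every $k\ge1$, whereas $h^-_{J_0}=2$ and $h^+_{J_0}=4$. In particular, $h^-_J$ is not a deformation invariant: there is an almost complex structure $J'$ that is joined to $J_0$ by a path of $\omega_0$-compatible almost complex structures, continuous in the $C^\infty$-topology, such that $h^-_{J'}\ne h^-_{J_0}$. -/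

import Mathlib

open scoped ContDiff Topology
open Filter

noncomputable section

namespace Torus4

/-- The coordinate space `ℝ⁴`: the universal cover of `𝕋⁴ = ℝ⁴ / ℤ⁴`, and also the tangent space
of `𝕋⁴` at each point, through the global frame `∂/∂x¹, …, ∂/∂x⁴`. The coordinates `x¹, …, x⁴`
have the indices `0, …, 3`. -/
abbrev V : Type := Fin 4 → ℝ

/-- Invariance under the lattice `ℤ⁴`. -/
def IsPeriodic {F : Type} (f : V → F) : Prop :=
  ∀ (n : Fin 4 → ℤ) (x : V), f (x + fun i => (n i : ℝ)) = f x

/-- Smooth `ℤ⁴`-periodic functions `ℝ⁴ → F`. -/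
def torusFieldSubmodule (F : Type) [NormedAddCommGroup F] [NormedSpace ℝ F] :
    Submodule ℝ (V → F) where
  carrier := {f | ContDiff ℝ ∞ f ∧ IsPeriodic f}
  add_mem' := by
    rintro f g ⟨hf, hf'⟩ ⟨hg, hg'⟩
    exact ⟨hf.add hg, fun n x => by simp only [Pi.add_apply, hf' n x, hg' n x]⟩
  zero_mem' := ⟨contDiff_const, fun _ _ => rfl⟩
  smul_mem' := by
    rintro c f ⟨hf, hf'⟩
    exact ⟨contDiff_const.smul hf, fun n x => by simp only [Pi.smul_apply, hf' n x]⟩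

/-- Smooth `F`-valued functions on `𝕋⁴ = ℝ⁴ / ℤ⁴`. When `F` is a space of tensors on `ℝ⁴`, these
are the smooth tensor fields on `𝕋⁴` of that type, as the tangent bundle is trivialised by the
coordinate frame. -/
def TorusField (F : Type) [NormedAddCommGroup F] [NormedSpace ℝ F] : Type :=
  torusFieldSubmodule F

namespace TorusField

variable {F : Type} [NormedAddCommGroup F] [NormedSpace ℝ F]

instance : AddCommGroup (TorusField F) := inferInstanceAs (AddCommGroup (torusFieldSubmodule F))

instance : Module ℝ (TorusField F) := inferInstanceAs (Module ℝ (torusFieldSubmodule F))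

instance : CoeFun (TorusField F) (fun _ => V → F) := ⟨Subtype.val⟩

/-- The `C^∞` topology: uniform convergence of all derivatives. -/
instance : TopologicalSpace (TorusField F) :=
  ⨅ m : ℕ, TopologicalSpace.induced
    (fun f : TorusField F => UniformFun.ofFun (iteratedFDeriv ℝ m f)) inferInstance

theorem contDiff (f : TorusField F) : ContDiff ℝ ∞ f := f.2.1

theorem periodic (f : TorusField F) : IsPeriodic f := f.2.2

theorem differentiable (f : TorusField F) : Differentiable ℝ f :=
  f.contDiff.differentiable (by simp)

theorem tendsto_iff {ι : Type} {l : Filter ι} {f : ι → TorusField F} {g : TorusField F} :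
    Tendsto f l (𝓝 g) ↔
      ∀ m : ℕ, TendstoUniformly (fun i => iteratedFDeriv ℝ m (f i)) (iteratedFDeriv ℝ m g) l := by
  simp only [nhds_iInf, tendsto_iInf, nhds_induced, tendsto_comap_iff,
    UniformFun.tendsto_iff_tendstoUniformly]
  rfl

/-- A constant tensor field. -/
def const (c : F) : TorusField F := ⟨fun _ => c, contDiff_const, fun _ _ => rfl⟩

end TorusField

/-! ### Differential forms and de Rham cohomology -/

/-- Smooth differential `p`-forms on `𝕋⁴`. -/
abbrev Form (p : ℕ) : Type := TorusField (V [⋀^Fin p]→L[ℝ] ℝ)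

theorem extDeriv_mem {p : ℕ} (α : Form p) :
    extDeriv (α : V → V [⋀^Fin p]→L[ℝ] ℝ) ∈
      torusFieldSubmodule (V [⋀^Fin (p + 1)]→L[ℝ] ℝ) := by
  constructor
  · exact (ContinuousAlternatingMap.alternatizeUncurryFinCLM ℝ V ℝ).contDiff.comp
      (α.contDiff.fderiv_right (m := ∞) (by simp))
  · intro n x
    have h : (fun y => α (y + fun i => (n i : ℝ))) = α := funext fun y => α.periodic n y
    simp only [extDeriv]
    rw [← fderiv_comp_add_right, h]

/-- The exterior derivative. -/
def d (p : ℕ) : Form p →ₗ[ℝ] Form (p + 1) where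
  toFun α := ⟨extDeriv α, extDeriv_mem α⟩
  map_add' α β := Subtype.ext <| funext fun x =>
    extDeriv_add (α.differentiable x) (β.differentiable x)
  map_smul' c α := Subtype.ext <| funext fun _ => extDeriv_smul c α.1

/-- The closed 2-forms. -/
abbrev Z2 : Submodule ℝ (Form 2) := LinearMap.ker (d 2)

/-- The exact 2-forms, as a subspace of the closed ones. -/
abbrev B2 : Submodule ℝ Z2 := (LinearMap.range (d 1)).comap Z2.subtype

/-- The de Rham cohomology group `H²(𝕋⁴; ℝ)`. -/
abbrev H2 : Type := Z2 ⧸ B2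

/-! ### Almost complex structures and their cohomology subgroups -/

/-- Smooth almost complex structures on `𝕋⁴`, with the `C^∞` topology. -/
abbrev AlmostComplex : Type :=
  {J : TorusField (V →L[ℝ] V) // ∀ x, (J x).comp (J x) = -ContinuousLinearMap.id ℝ V}

/-- `Ω_J^+` for `ε = 1` and `Ω_J^-` for `ε = -1`: the 2-forms with `α(J·, J·) = ε α`. -/
def OmegaJ (ε : ℝ) (J : AlmostComplex) : Submodule ℝ (Form 2) where
  carrier := {α | ∀ x u v, α x ![J.1 x u, J.1 x v] = ε * α x ![u, v]}
  add_mem' := by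
    intro α β hα hβ x u v
    change α x _ + β x _ = ε * (α x _ + β x _)
    rw [hα x u v, hβ x u v, mul_add]
  zero_mem' := by
    intro x u v
    change (0 : ℝ) = ε * 0
    simp
  smul_mem' := by
    intro c α hα x u v
    change c * α x _ = ε * (c * α x _)
    rw [hα x u v]
    ring

/-- The classes in `H²(𝕋⁴; ℝ)` that are represented by a closed form in `OmegaJ ε J`. -/
def HJ (ε : ℝ) (J : AlmostComplex) : Submodule ℝ H2 :=
  ((OmegaJ ε J).comap Z2.subtype).map B2.mkQ

/-- `h_J^+ = dim H_J^+`, as a cardinal. -/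
def hPlus (J : AlmostComplex) : Cardinal := Module.rank ℝ (HJ 1 J)

/-- `h_J^- = dim H_J^-`, as a cardinal. -/
def hMinus (J : AlmostComplex) : Cardinal := Module.rank ℝ (HJ (-1) J)

/-- `J` is `w`-compatible: `w(X, JX) > 0` for `X ≠ 0`, and `w(JX, JY) = w(X, Y)`. -/
def IsCompatible (w : Form 2) (J : AlmostComplex) : Prop :=
  (∀ x u, u ≠ 0 → 0 < w x ![u, J.1 x u]) ∧
    ∀ x u v, w x ![J.1 x u, J.1 x v] = w x ![u, v]

/-- Smooth fields of bilinear forms on `𝕋⁴`. -/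
abbrev BilinField : Type := TorusField (V →L[ℝ] V →L[ℝ] ℝ)

/-- A 2-covector `a` as the bilinear form `(u, v) ↦ a(u, v)`, linearly in `a`. -/
def toBilin : (V [⋀^Fin 2]→L[ℝ] ℝ) →L[ℝ] V →L[ℝ] V →L[ℝ] ℝ :=
  (ContinuousLinearMap.compL ℝ V (V [⋀^Fin 1]→L[ℝ] ℝ) (V →L[ℝ] ℝ)
      (ContinuousAlternatingMap.ofSubsingletonLIE (𝕜 := ℝ) (E := V) (F := ℝ)
        (0 : Fin 1)).symm.toContinuousLinearEquiv.toContinuousLinearMap).comp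
    (ContinuousAlternatingMap.curryLeftLI (n := 1)
      (𝕜 := ℝ) (E := V) (F := ℝ)).toContinuousLinearMap

theorem toBilin_apply (a : V [⋀^Fin 2]→L[ℝ] ℝ) (u v : V) : toBilin a u v = a ![u, v] := by
  change a (Matrix.vecCons u fun _ => v) = a ![u, v]
  congr 1
  ext i
  fin_cases i <;> rfl

/-- The field of bilinear forms `g(·, ·) = w(·, J ·)`. -/
def metricOf (w : Form 2) (J : AlmostComplex) : BilinField :=
  ⟨fun x => (toBilin (w x)).bilinearComp (ContinuousLinearMap.id ℝ V) (J.1 x), by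
    constructor
    · refine contDiff_clm_apply_iff.2 fun u => contDiff_clm_apply_iff.2 fun v => ?_
      change ContDiff ℝ ∞ fun x => toBilin (w x) u (J.1 x v)
      have hJ := J.1.contDiff
      have hw := w.contDiff
      fun_prop
    · intro n x
      simp only [w.periodic n x, J.1.periodic n x]⟩

theorem metricOf_apply (w : Form 2) (J : AlmostComplex) (x u v : V) :
    metricOf w J x u v = w x ![u, J.1 x v] :=
  toBilin_apply _ _ _

/-! ### The flat Kähler structure -/

/-- The coordinate covector `dxⁱ`. -/
def dx (i : Fin 4) : V →L[ℝ] ℝ := ContinuousLinearMap.proj i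

/-- The 2-covector `dxⁱ ∧ dxʲ`. -/
def dxWedge (i j : Fin 4) : V [⋀^Fin 2]→L[ℝ] ℝ where
  toFun v := dx i (v 0) * dx j (v 1) - dx i (v 1) * dx j (v 0)
  map_update_add' := by
    intro _ m k a b
    fin_cases k <;> simp [Function.update] <;> ring
  map_update_smul' := by
    intro _ m k c a
    fin_cases k <;> simp [Function.update] <;> ring
  map_eq_zero_of_eq' := by
    intro v k l h hkl
    fin_cases k <;> fin_cases l <;> simp_all
  cont := by fun_prop

/-- `ω₀ = dx¹ ∧ dx² + dx³ ∧ dx⁴`. -/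
def omega0 : Form 2 := TorusField.const (dxWedge 0 1 + dxWedge 2 3)

/-- `g₀ = ∑ dxⁱ ⊗ dxⁱ`. -/
def g0 : BilinField := TorusField.const (∑ i, (dx i).smulRight (dx i))

/-- The endomorphism with `∂₁ ↦ c⁻¹ ∂₂`, `∂₂ ↦ -c ∂₁`, `∂₃ ↦ e⁻¹ ∂₄`, `∂₄ ↦ -e ∂₃`. -/
def blockEnd (c e : ℝ) : V →L[ℝ] V :=
  c⁻¹ • (dx 0).smulRight (Pi.single 1 1) - c • (dx 1).smulRight (Pi.single 0 1) +
    e⁻¹ • (dx 2).smulRight (Pi.single 3 1) - e • (dx 3).smulRight (Pi.single 2 1)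

theorem blockEnd_comp {c e : ℝ} (hc : c ≠ 0) (he : e ≠ 0) :
    (blockEnd c e).comp (blockEnd c e) = -ContinuousLinearMap.id ℝ V := by
  ext v i
  fin_cases i <;> simp [blockEnd, dx, hc, he]

/-- The action of `J` on covectors, `(Jα)(X) = -α(JX) = α(J⁻¹X)`. -/
def coAct (J : AlmostComplex) (x : V) (a : V →L[ℝ] ℝ) : V →L[ℝ] ℝ := -(a.comp (J.1 x))

/-- The standard complex structure `J₀`. -/
def J0 : AlmostComplex :=
  ⟨TorusField.const (blockEnd 1 1), fun _ => blockEnd_comp one_ne_zero one_ne_zero⟩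

/-! ### The deformed structures -/

/-- `A_k = exp ((1/k) sin 2π(x¹ + x³))`. -/
def A (k : ℕ) (x : V) : ℝ := Real.exp (1 / k * Real.sin (2 * Real.pi * (x 0 + x 2)))

/-- `B_k = exp ((1/k) sin 2π(x¹ + x⁴))`. -/
def B (k : ℕ) (x : V) : ℝ := Real.exp (1 / k * Real.sin (2 * Real.pi * (x 0 + x 3)))

/-- `C_k = (A_k / B_k)^{1/2}`. -/
def C (k : ℕ) (x : V) : ℝ := Real.sqrt (A k x / B k x)

/-- `D_k = (1 / (A_k B_k))^{1/2}`. -/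
def D (k : ℕ) (x : V) : ℝ := Real.sqrt (1 / (A k x * B k x))

theorem A_pos (k : ℕ) (x : V) : 0 < A k x := Real.exp_pos _

theorem B_pos (k : ℕ) (x : V) : 0 < B k x := Real.exp_pos _

theorem C_pos (k : ℕ) (x : V) : 0 < C k x := Real.sqrt_pos.2 (div_pos (A_pos k x) (B_pos k x))

theorem D_pos (k : ℕ) (x : V) : 0 < D k x :=
  Real.sqrt_pos.2 (one_div_pos.2 (mul_pos (A_pos k x) (B_pos k x)))

theorem A_contDiff (k : ℕ) : ContDiff ℝ ∞ (A k) := by unfold A; fun_prop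

theorem B_contDiff (k : ℕ) : ContDiff ℝ ∞ (B k) := by unfold B; fun_prop

theorem C_contDiff (k : ℕ) : ContDiff ℝ ∞ (C k) :=
  ((A_contDiff k).div (B_contDiff k) fun x => (B_pos k x).ne').sqrt
    fun x => (div_pos (A_pos k x) (B_pos k x)).ne'

theorem D_contDiff (k : ℕ) : ContDiff ℝ ∞ (D k) :=
  (contDiff_const.div ((A_contDiff k).mul (B_contDiff k))
    fun x => (mul_pos (A_pos k x) (B_pos k x)).ne').sqrt
    fun x => (one_div_pos.2 (mul_pos (A_pos k x) (B_pos k x))).ne'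

theorem sin_shift (t : ℝ) (n : ℤ) :
    Real.sin (2 * Real.pi * (t + n)) = Real.sin (2 * Real.pi * t) := by
  rw [show 2 * Real.pi * (t + n) = 2 * Real.pi * t + n * (2 * Real.pi) by ring]
  exact Real.sin_add_int_mul_two_pi _ _

theorem A_periodic (k : ℕ) : IsPeriodic (A k) := by
  intro n x
  have h := sin_shift (x 0 + x 2) (n 0 + n 2)
  simp only [A, Pi.add_apply]
  rw [← h]
  push_cast
  ring_nf

theorem B_periodic (k : ℕ) : IsPeriodic (B k) := by
  intro n x
  have h := sin_shift (x 0 + x 3) (n 0 + n 3)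
  simp only [B, Pi.add_apply]
  rw [← h]
  push_cast
  ring_nf

/-- The almost complex structures `J_k`. -/
def J (k : ℕ) : AlmostComplex :=
  ⟨⟨fun x => blockEnd (C k x) (D k x), by
    constructor
    · have hC := C_contDiff k
      have hD := D_contDiff k
      have hC' := hC.inv fun x => (C_pos k x).ne'
      have hD' := hD.inv fun x => (D_pos k x).ne'
      exact (((hC'.smul contDiff_const).sub (hC.smul contDiff_const)).add
        (hD'.smul contDiff_const)).sub (hD.smul contDiff_const)
    · intro n x
      simp only [C, D, A_periodic k n x, B_periodic k n x]⟩,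
    fun x => blockEnd_comp (C_pos k x).ne' (D_pos k x).ne'⟩

/-- The metrics `g_k = ω₀(·, J_k ·)`. -/
def g (k : ℕ) : BilinField := metricOf omega0 (J k)

end Torus4

end

open Torus4

noncomputable section

namespace Torus4

/-! ### Smoothness of averages along segments -/

open MeasureTheory

variable {F G : Type} [NormedAddCommGroup F] [NormedSpace ℝ F] [NormedAddCommGroup G]
  [NormedSpace ℝ G]

/-! Indices run over 0, …, 3. Averaging a closed 2-form over the torus changes it by an exact form
and yields a constant form, which is zero exactly when the class is. So the six averaged
coefficients embed H² in ℝ⁶, and h_J^± is the dimension of the space of averages of closed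
J-(anti-)invariant forms (`rank_HJ`).

All J_k lie on one smooth path `family s`, at s = 1/k, with J₀ at s = 0. Write A = exp(s sin
2π(x⁰+x²)) and B = exp(s sin 2π(x⁰+x³)). Then CD = 1/B and C/D = A, and α(J·,J·) = εα means α₀₁ =
εα₀₁, α₂₃ = εα₂₃, α₁₃ = εα₀₂/B, α₁₂ = -εAα₀₃.

Let s ≠ 0. For ε = -1, put f = α₀₂ and h = α₀₃. Two components of dα = 0 form a Cauchy–Riemann type
system in (x²,x³), and an energy identity makes f and h independent of x² and x³
(`pd_eq_zero_of_cauchyRiemann`). The other two components are ∂₀(Ah) = ∂₁f and ∂₀(f/B) = -∂₁h. There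
A and B still vary with x² and x³ while everything else does not, which forces h = 0 and then f = 0
(`eq_zero_of_pd_expWave_mul`). Hence h^- = 0.

For ε = 1, six explicit closed invariant forms built from plane waves have independent periods.
Independence amounts to mean(A)·mean(1/A) ≠ 1, and likewise for B: the strict Cauchy–Schwarz
inequality for a nonconstant function (`meanValue_expWave_mul_ne_one`). Hence h^+ = 6.

At s = 0 the invariance conditions have constant coefficients and pass to averages, which gives
dimensions 2 and 4. -/

theorem hasFDerivAt_segmentIntegral {w : ℝ → ℝ} (hw : Continuous w) (v : V) {f : V → F}
    (hf : ContDiff ℝ 1 f) (x : V) :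
    HasFDerivAt (fun x => ∫ t in (0 : ℝ)..1, w t • f (x + t • v))
      (∫ t in (0 : ℝ)..1, w t • fderiv ℝ f (x + t • v)) x := by
  have hf' : Continuous (fderiv ℝ f) := hf.continuous_fderiv one_ne_zero
  have hfc := hf.continuous
  have hK : IsCompact (Metric.closedBall x 1 ×ˢ Set.uIcc (0 : ℝ) 1) :=
    (isCompact_closedBall x 1).prod isCompact_uIcc
  obtain ⟨M, hM⟩ := hK.exists_bound_of_continuousOn
    (f := fun p : V × ℝ => w p.2 • fderiv ℝ f (p.1 + p.2 • v)) (by fun_prop)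
  refine intervalIntegral.hasFDerivAt_integral_of_dominated_of_fderiv_le
    (F' := fun x t => w t • fderiv ℝ f (x + t • v)) (bound := fun _ => M)
    (Metric.closedBall_mem_nhds x one_pos) ?_ ?_ ?_ ?_ ?_ ?_
  · exact Eventually.of_forall fun y => (by fun_prop : Continuous fun t : ℝ =>
      w t • f (y + t • v)).aestronglyMeasurable
  · exact (by fun_prop : Continuous fun t : ℝ => w t • f (x + t • v)).intervalIntegrable _ _
  · exact (by fun_prop : Continuous fun t : ℝ =>
      w t • fderiv ℝ f (x + t • v)).aestronglyMeasurable
  · exact Eventually.of_forall fun t ht y hy => hM (y, t) ⟨hy, Set.uIoc_subset_uIcc ht⟩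
  · exact intervalIntegrable_const
  · refine Eventually.of_forall fun t _ y _ => HasFDerivAt.const_smul ?_ (w t)
    exact (hasFDerivAt_comp_add_right (t • v)).2 ((hf.differentiable one_ne_zero) _).hasFDerivAt

/-- The derivative is an integral of the same shape with values in `V →L[ℝ] F`, so the induction has
to range over all target spaces. -/
theorem contDiff_segmentIntegral_nat (n : ℕ) {w : ℝ → ℝ} (hw : Continuous w) (v : V) :
    ∀ {F : Type} [NormedAddCommGroup F] [NormedSpace ℝ F] {f : V → F}, ContDiff ℝ ∞ f →
      ContDiff ℝ n (fun x => ∫ t in (0 : ℝ)..1, w t • f (x + t • v)) := by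
  induction n with
  | zero =>
    intro F _ _ f hf
    exact contDiff_zero.2 (continuous_iff_continuousAt.2 fun x =>
      (hasFDerivAt_segmentIntegral hw v (hf.of_le (by simp)) x).continuousAt)
  | succ n ih =>
    intro F _ _ f hf
    have h := hasFDerivAt_segmentIntegral hw v (hf.of_le (by simp : (1 : WithTop ℕ∞) ≤ ∞))
    push_cast
    refine contDiff_succ_iff_fderiv.2 ⟨fun x => (h x).differentiableAt, by simp, ?_⟩
    rw [funext fun x => (h x).fderiv]
    exact ih (hf.fderiv_right (m := ∞) (by simp))

theorem contDiff_segmentIntegral {w : ℝ → ℝ} (hw : Continuous w) (v : V) {f : V → F}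
    (hf : ContDiff ℝ ∞ f) :
    ContDiff ℝ ∞ (fun x => ∫ t in (0 : ℝ)..1, w t • f (x + t • v)) :=
  contDiff_infty.2 fun n => contDiff_segmentIntegral_nat n hw v hf

/-! ### Calculus and averaging of periodic fields -/

namespace TorusField

@[ext]
theorem ext {f g : TorusField F} (h : ∀ x, f x = g x) : f = g := Subtype.ext (funext h)

@[simp] theorem add_apply (f g : TorusField F) (x : V) : (f + g) x = f x + g x := rfl
@[simp] theorem sub_apply (f g : TorusField F) (x : V) : (f - g) x = f x - g x := rfl
@[simp] theorem neg_apply (f : TorusField F) (x : V) : (-f) x = -f x := rfl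
@[simp] theorem smul_apply (c : ℝ) (f : TorusField F) (x : V) : (c • f) x = c • f x := rfl
@[simp] theorem zero_apply (x : V) : (0 : TorusField F) x = 0 := rfl
@[simp] theorem const_apply (c : F) (x : V) : const c x = c := rfl

theorem continuous (f : TorusField F) : Continuous f := f.contDiff.continuous

/-- Composition with a continuous linear map of the fibres. -/
def map (L : F →L[ℝ] G) : TorusField F →ₗ[ℝ] TorusField G where
  toFun f := ⟨fun x => L (f x), L.contDiff.comp f.contDiff, fun n x => by
    simp only [f.periodic n x]⟩
  map_add' f g := ext fun x => L.map_add _ _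
  map_smul' c f := ext fun x => L.map_smul _ _

@[simp] theorem map_apply (L : F →L[ℝ] G) (f : TorusField F) (x : V) : map L f x = L (f x) := rfl

/-- The total derivative. -/
def deriv : TorusField F →ₗ[ℝ] TorusField (V →L[ℝ] F) where
  toFun f := ⟨fderiv ℝ f, f.contDiff.fderiv_right (m := ∞) (by simp), fun n x => by
    have h : (fun y => f (y + fun i => (n i : ℝ))) = f := funext fun y => f.periodic n y
    rw [← fderiv_comp_add_right, h]⟩
  map_add' f g := ext fun x => fderiv_add (f.differentiable x) (g.differentiable x)
  map_smul' c f := ext fun x => fderiv_const_smul (f.differentiable x) c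

theorem deriv_apply (f : TorusField F) (x : V) : deriv f x = fderiv ℝ f x := rfl

/-- The derivative in the direction `v`. -/
def pd (v : V) : TorusField F →ₗ[ℝ] TorusField F :=
  (map (ContinuousLinearMap.apply ℝ F v)).comp deriv

theorem pd_apply (v : V) (f : TorusField F) (x : V) : pd v f x = fderiv ℝ f x v := rfl

theorem hasFDerivAt (f : TorusField F) (x : V) : HasFDerivAt f (deriv f x) x :=
  (f.differentiable x).hasFDerivAt

theorem deriv_map (L : F →L[ℝ] G) (f : TorusField F) :
    deriv (map L f) = map (ContinuousLinearMap.compL ℝ V F G L) (deriv f) :=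
  ext fun x => (L.hasFDerivAt.comp x (f.hasFDerivAt x)).fderiv

theorem pd_map (L : F →L[ℝ] G) (v : V) (f : TorusField F) : pd v (map L f) = map L (pd v f) := by
  change map _ (deriv _) = _
  rw [deriv_map]
  rfl

/-- The weighted average of `f` over the segments `[x, x + v]`. -/
def wavg (w : C(ℝ, ℝ)) (v : V) : TorusField F →ₗ[ℝ] TorusField F where
  toFun f := ⟨fun x => ∫ t in (0 : ℝ)..1, w t • f (x + t • v),
    contDiff_segmentIntegral w.continuous v f.contDiff, fun n x => by
      simp only [add_right_comm x _ (_ • v), f.periodic n _]⟩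
  map_add' f g := ext fun x => by
    have hf := f.continuous
    have hg := g.continuous
    have hw := w.continuous
    change ∫ t in (0 : ℝ)..1, w t • (f (x + t • v) + g (x + t • v)) = _
    simp only [smul_add]
    exact intervalIntegral.integral_add
      ((by fun_prop : Continuous fun t : ℝ => w t • f (x + t • v)).intervalIntegrable _ _)
      ((by fun_prop : Continuous fun t : ℝ => w t • g (x + t • v)).intervalIntegrable _ _)
  map_smul' c f := ext fun x => by
    change ∫ t in (0 : ℝ)..1, w t • c • f (x + t • v) = _
    simp only [smul_comm _ c]
    exact intervalIntegral.integral_smul _ _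

theorem wavg_apply (w : C(ℝ, ℝ)) (v : V) (f : TorusField F) (x : V) :
    wavg w v f x = ∫ t in (0 : ℝ)..1, w t • f (x + t • v) := rfl

theorem intervalIntegrable_segment (w : C(ℝ, ℝ)) (v : V) (f : TorusField F) (x : V) :
    IntervalIntegrable (fun t : ℝ => w t • f (x + t • v)) volume 0 1 := by
  have hf := f.continuous
  have hw := w.continuous
  exact (by fun_prop : Continuous fun t : ℝ => w t • f (x + t • v)).intervalIntegrable _ _

theorem deriv_wavg (w : C(ℝ, ℝ)) (v : V) (f : TorusField F) :
    deriv (wavg w v f) = wavg w v (deriv f) :=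
  ext fun x => (hasFDerivAt_segmentIntegral w.continuous v
    (f.contDiff.of_le (by simp)) x).fderiv

theorem wavg_map [CompleteSpace F] [CompleteSpace G] (w : C(ℝ, ℝ)) (v : V) (L : F →L[ℝ] G)
    (f : TorusField F) : wavg w v (map L f) = map L (wavg w v f) :=
  ext fun x => by
    simp only [wavg_apply, map_apply, ← L.map_smul]
    exact L.intervalIntegral_comp_comm (intervalIntegrable_segment w v f x)

theorem pd_wavg [CompleteSpace F] (w : C(ℝ, ℝ)) (v u : V) (f : TorusField F) :
    pd u (wavg w v f) = wavg w v (pd u f) := by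
  change map _ (deriv _) = wavg w v (map _ (deriv f))
  rw [deriv_wavg, wavg_map]

theorem hasDerivAt_segment (f : TorusField F) (v x : V) (t : ℝ) :
    HasDerivAt (fun t : ℝ => f (x + t • v)) (pd v f (x + t • v)) t := by
  have h := ((hasDerivAt_id t).smul_const v).const_add x
  simpa [pd_apply, deriv_apply, Function.comp_def] using
    (f.hasFDerivAt (x + t • v)).comp_hasDerivAt t h

/-- The basis vector `∂ᵢ`. -/
abbrev e (i : Fin 4) : V := Pi.single i 1

theorem apply_add_e (f : TorusField F) (i : Fin 4) (x : V) : f (x + e i) = f x := by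
  have h : e i = fun j => (((Pi.single i 1 : Fin 4 → ℤ) j : ℤ) : ℝ) := by
    funext j
    by_cases h : j = i <;> simp [h]
  rw [h]
  exact f.periodic _ x

/-- The average of `f` over the segments `[x, x + v]`. -/
abbrev avg (v : V) : TorusField F →ₗ[ℝ] TorusField F := wavg 1 v

theorem avg_apply (v : V) (f : TorusField F) (x : V) :
    avg v f x = ∫ t in (0 : ℝ)..1, f (x + t • v) := by
  simp [wavg_apply]

theorem avg_pd [CompleteSpace F] (i : Fin 4) (f : TorusField F) : avg (e i) (pd (e i) f) = 0 := by
  ext x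
  have h := (pd (e i) f).continuous
  rw [avg_apply, intervalIntegral.integral_eq_sub_of_hasDerivAt
    (fun t _ => hasDerivAt_segment f (e i) x t)
    ((by fun_prop : Continuous fun t : ℝ => pd (e i) f (x + t • e i)).intervalIntegrable _ _)]
  simp [apply_add_e]

/-- The weight `1 - t`. -/
def descent : C(ℝ, ℝ) := ⟨fun t => 1 - t, by fun_prop⟩

/-- Integration by parts: the weight vanishes at t = 1, its boundary term at t = 0 gives `-f`, and
its slope -1 gives the plain average. -/
theorem wavg_descent_pd [CompleteSpace F] (v : V) (f : TorusField F) :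
    wavg descent v (pd v f) = avg v f - f := by
  ext x
  have hf := f.continuous
  have h := (pd v f).continuous
  have h1 : ∀ t : ℝ, HasDerivAt (fun t : ℝ => 1 - t) (-1) t := fun t => by
    simpa using (hasDerivAt_id t).const_sub 1
  rw [wavg_apply, sub_apply, avg_apply]
  change ∫ t in (0 : ℝ)..1, (1 - t) • pd v f (x + t • v) = _
  rw [intervalIntegral.integral_smul_deriv_eq_deriv_smul (fun t _ => h1 t)
    (fun t _ => hasDerivAt_segment f v x t)
    intervalIntegrable_const
    ((by fun_prop : Continuous fun t : ℝ => pd v f (x + t • v)).intervalIntegrable _ _)]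
  simp
  abel

theorem avg_nonneg {f : TorusField ℝ} (hf : ∀ x, 0 ≤ f x) (v x : V) : 0 ≤ avg v f x := by
  rw [avg_apply]
  exact intervalIntegral.integral_nonneg zero_le_one fun t _ => hf _

theorem eq_zero_of_avg_eq_zero {f : TorusField ℝ} (hf : ∀ x, 0 ≤ f x) {v : V}
    (h : avg v f = 0) : f = 0 := by
  ext x
  by_contra hx
  have hfc := f.continuous
  have h0 : 0 < f x := lt_of_le_of_ne (hf x) (Ne.symm hx)
  have := intervalIntegral.integral_pos (f := fun t : ℝ => f (x + t • v)) zero_lt_one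
    (by fun_prop) (fun t _ => hf _) ⟨0, by simp, by simpa using h0⟩
  rw [← avg_apply, h] at this
  exact lt_irrefl _ this

/-- The mean value, as a constant field. -/
def mean : TorusField F →ₗ[ℝ] TorusField F := avg (e 3) ∘ₗ avg (e 2) ∘ₗ avg (e 1) ∘ₗ avg (e 0)

theorem mean_apply (f : TorusField F) : mean f = avg (e 3) (avg (e 2) (avg (e 1) (avg (e 0) f))) :=
  rfl

theorem pd_mean [CompleteSpace F] (u : V) (f : TorusField F) : pd u (mean f) = mean (pd u f) := by
  simp only [mean_apply, pd_wavg]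

theorem mean_map [CompleteSpace F] [CompleteSpace G] (L : F →L[ℝ] G) (f : TorusField F) :
    mean (map L f) = map L (mean f) := by
  simp only [mean_apply, wavg_map]

/-- The derivative commutes outwards through the inner averages until it meets the average in its
own direction, which kills it by periodicity. -/
theorem mean_pd [CompleteSpace F] (i : Fin 4) (f : TorusField F) : mean (pd (e i) f) = 0 := by
  fin_cases i
  · change avg (e 3) (avg (e 2) (avg (e 1) (avg (e 0) (pd (e 0) f)))) = 0
    simp only [avg_pd, map_zero]
  · change avg (e 3) (avg (e 2) (avg (e 1) (avg (e 0) (pd (e 1) f)))) = 0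
    simp only [avg, ← pd_wavg 1 (e 0)]
    simp only [avg_pd, map_zero]
  · change avg (e 3) (avg (e 2) (avg (e 1) (avg (e 0) (pd (e 2) f)))) = 0
    simp only [avg, ← pd_wavg 1 (e 0), ← pd_wavg 1 (e 1)]
    simp only [avg_pd, map_zero]
  · change avg (e 3) (avg (e 2) (avg (e 1) (avg (e 0) (pd (e 3) f)))) = 0
    simp only [avg, ← pd_wavg 1 (e 0), ← pd_wavg 1 (e 1), ← pd_wavg 1 (e 2)]
    simp only [avg_pd]

theorem eq_const_of_pd_eq_zero {f : TorusField F} (h : ∀ i, pd (e i) f = 0) :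
    f = const (f 0) := by
  have h0 : ∀ x, fderiv ℝ f x = 0 := fun x => by
    refine ContinuousLinearMap.coe_injective ((Pi.basisFun ℝ (Fin 4)).ext fun i => ?_)
    simpa [pd_apply] using congrArg (fun g : TorusField F => g x) (h i)
  exact ext fun x => is_const_of_fderiv_eq_zero f.differentiable h0 x 0

theorem mean_eq_const [CompleteSpace F] (f : TorusField F) : mean f = const (mean f 0) :=
  eq_const_of_pd_eq_zero fun i => by rw [pd_mean, mean_pd]

theorem avg_const [CompleteSpace F] (v : V) (c : F) : avg v (const c) = const c := by
  ext x
  simp [avg_apply]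

theorem mean_const [CompleteSpace F] (c : F) : mean (const c) = const c := by
  simp only [mean_apply, avg_const]

theorem eq_zero_of_mean_eq_zero {f : TorusField ℝ} (hf : ∀ x, 0 ≤ f x) (h : mean f = 0) :
    f = 0 := by
  have h0 := avg_nonneg hf (e 0)
  have h1 := avg_nonneg h0 (e 1)
  have h2 := avg_nonneg h1 (e 2)
  exact eq_zero_of_avg_eq_zero hf (eq_zero_of_avg_eq_zero h0 (eq_zero_of_avg_eq_zero h1
    (eq_zero_of_avg_eq_zero h2 h)))

/-- The average of `f` over `𝕋⁴`. -/
def meanValue : TorusField F →ₗ[ℝ] F where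
  toFun f := mean f 0
  map_add' f g := by rw [map_add, add_apply]
  map_smul' c f := by rw [map_smul, smul_apply]; rfl

theorem mean_eq [CompleteSpace F] (f : TorusField F) : mean f = const (meanValue f) :=
  mean_eq_const f

theorem meanValue_map [CompleteSpace F] [CompleteSpace G] (L : F →L[ℝ] G) (f : TorusField F) :
    meanValue (map L f) = L (meanValue f) := by
  change mean (map L f) 0 = _
  rw [mean_map]
  rfl

theorem meanValue_const [CompleteSpace F] (c : F) : meanValue (const c) = c := by
  change mean (const c) 0 = c
  rw [mean_const, const_apply]

theorem eq_zero_of_meanValue_eq_zero {f : TorusField ℝ} (hf : ∀ x, 0 ≤ f x)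
    (h : meanValue f = 0) : f = 0 :=
  eq_zero_of_mean_eq_zero hf (by rw [mean_eq, h]; rfl)

end TorusField

/-! ### Exterior derivative, periods and cohomology -/

open TorusField

/-- Evaluation of 2-covectors at `(u, v)`. -/
def ev (u v : V) : (V [⋀^Fin 2]→L[ℝ] ℝ) →L[ℝ] ℝ :=
  (ContinuousLinearMap.apply ℝ ℝ v).comp ((ContinuousLinearMap.apply ℝ (V →L[ℝ] ℝ) u).comp toBilin)

@[simp] theorem ev_apply (u v : V) (a : V [⋀^Fin 2]→L[ℝ] ℝ) : ev u v a = a ![u, v] :=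
  toBilin_apply a u v

/-- The interior product with `v`. -/
def interior (v : V) : (V [⋀^Fin 2]→L[ℝ] ℝ) →L[ℝ] (V [⋀^Fin 1]→L[ℝ] ℝ) :=
  (ContinuousLinearMap.apply ℝ _ v).comp
    (ContinuousAlternatingMap.curryLeftLI (n := 1)
      (𝕜 := ℝ) (E := V) (F := ℝ)).toContinuousLinearMap

theorem interior_apply (v u : V) (a : V [⋀^Fin 2]→L[ℝ] ℝ) : interior v a ![u] = a ![v, u] := rfl

theorem d_eq_map {p : ℕ} (α : Form p) :
    d p α = map (ContinuousAlternatingMap.alternatizeUncurryFinCLM ℝ V ℝ) (deriv α) := rfl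

theorem d_wavg {p : ℕ} (w : C(ℝ, ℝ)) (v : V) (α : Form p) :
    d p (wavg w v α) = wavg w v (d p α) := by
  rw [d_eq_map, d_eq_map, deriv_wavg, wavg_map]

theorem d_const {p : ℕ} (a : V [⋀^Fin p]→L[ℝ] ℝ) : d p (const a) = 0 := by
  have h : deriv (const a) = 0 := TorusField.ext fun x => (hasFDerivAt_const a x).fderiv
  rw [d_eq_map, h, map_zero]

theorem d_mean {p : ℕ} (α : Form p) : mean (d p α) = 0 := by
  have h : mean (d p α) = d p (mean α) := by simp only [mean_apply, d_wavg]
  rw [h, mean_eq, d_const]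

theorem d_one_apply (β : Form 1) (x u v : V) :
    d 1 β x ![u, v] = pd u β x ![v] - pd v β x ![u] := by
  rw [d_eq_map, map_apply]
  simp only [ContinuousAlternatingMap.alternatizeUncurryFinCLM_apply,
    ContinuousAlternatingMap.alternatizeUncurryFin_apply]
  refine (Fin.sum_univ_two _).trans ?_
  have h0 : (0 : Fin 2).removeNth ![u, v] = ![v] := by ext i; fin_cases i; rfl
  have h1 : (1 : Fin 2).removeNth ![u, v] = ![u] := by ext i; fin_cases i; rfl
  rw [h0, h1]
  simp [pd_apply, deriv_apply, sub_eq_add_neg]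

theorem d_two_apply (α : Form 2) (x u v w : V) :
    d 2 α x ![u, v, w] = pd u α x ![v, w] - pd v α x ![u, w] + pd w α x ![u, v] := by
  rw [d_eq_map, map_apply]
  simp only [ContinuousAlternatingMap.alternatizeUncurryFinCLM_apply,
    ContinuousAlternatingMap.alternatizeUncurryFin_apply]
  refine (Fin.sum_univ_three _).trans ?_
  have h0 : (0 : Fin 3).removeNth ![u, v, w] = ![v, w] := by ext i; fin_cases i <;> rfl
  have h1 : (1 : Fin 3).removeNth ![u, v, w] = ![u, w] := by ext i; fin_cases i <;> rfl
  have h2 : (2 : Fin 3).removeNth ![u, v, w] = ![u, v] := by ext i; fin_cases i <;> rfl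
  rw [h0, h1, h2]
  simp [pd_apply, deriv_apply, sub_eq_add_neg]

/-- Cartan's formula for the interior product of a closed form with a constant field. -/
theorem d_interior {α : Form 2} (hα : d 2 α = 0) (v : V) :
    d 1 (map (interior v) α) = pd v α := by
  refine TorusField.ext fun x => ContinuousAlternatingMap.ext fun m => ?_
  obtain ⟨u, w, rfl⟩ : ∃ u w, m = ![u, w] := ⟨m 0, m 1, by ext i; fin_cases i <;> rfl⟩
  have h := d_two_apply α x v u w
  rw [hα] at h
  rw [d_one_apply, pd_map, pd_map, map_apply, map_apply, interior_apply, interior_apply]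
  change (0 : ℝ) = _ at h
  linarith

/-- Homotopy formula for translation along `v`: the primitive averages the interior product with
weight 1 - t, and Cartan's formula reduces the claim to the integration by parts above. -/
theorem avg_sub_exact {α : Form 2} (hα : d 2 α = 0) (v : V) :
    avg v α - α ∈ LinearMap.range (d 1) :=
  ⟨wavg descent v (map (interior v) α), by rw [d_wavg, d_interior hα, wavg_descent_pd]⟩

theorem mean_sub_exact {α : Form 2} (hα : d 2 α = 0) : mean α - α ∈ LinearMap.range (d 1) := by
  have key : ∀ {α : Form 2} (v : V), d 2 α = 0 → d 2 (avg v α) = 0 := fun v h => by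
    rw [d_wavg, h, map_zero]
  have h1 := key (e 0) hα
  have h2 := key (e 1) h1
  have h3 := key (e 2) h2
  have := add_mem (add_mem (avg_sub_exact hα (e 0)) (avg_sub_exact h1 (e 1)))
    (add_mem (avg_sub_exact h2 (e 2)) (avg_sub_exact h3 (e 3)))
  convert this using 1
  rw [mean_apply]
  abel

/-- The coefficients of a 2-covector. -/
def coeffs : (V [⋀^Fin 2]→L[ℝ] ℝ) →ₗ[ℝ] Fin 6 → ℝ where
  toFun a := ![a ![e 0, e 1], a ![e 2, e 3], a ![e 0, e 2], a ![e 1, e 3], a ![e 0, e 3],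
    a ![e 1, e 2]]
  map_add' a b := by ext i; fin_cases i <;> rfl
  map_smul' c a := by ext i; fin_cases i <;> rfl

theorem swap_apply (a : V [⋀^Fin 2]→L[ℝ] ℝ) (u v : V) : a ![v, u] = -a ![u, v] := by
  have h := a.map_swap ![u, v] (zero_ne_one : (0 : Fin 2) ≠ 1)
  refine Eq.trans ?_ h
  change a _ = a _
  congr 1
  ext i
  fin_cases i <;> rfl

theorem covector_ext {a b : V [⋀^Fin 2]→L[ℝ] ℝ}
    (h : ∀ i j, i < j → a ![e i, e j] = b ![e i, e j]) : a = b := by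
  refine ContinuousAlternatingMap.toAlternatingMap_injective
    ((Pi.basisFun ℝ (Fin 4)).ext_alternating fun s hs => ?_)
  have hm : (fun i => Pi.basisFun ℝ (Fin 4) (s i)) = ![e (s 0), e (s 1)] := by
    ext i : 1
    fin_cases i <;> simp
  rw [hm]
  change a _ = b _
  rcases lt_trichotomy (s 0) (s 1) with hlt | heq | hgt
  · exact h _ _ hlt
  · exact absurd (hs heq) zero_ne_one
  · rw [swap_apply a (e (s 1)), swap_apply b (e (s 1)), h _ _ hgt]

theorem coeffs_injective : Function.Injective coeffs := by
  intro a b hab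
  have h : ∀ i, coeffs a i = coeffs b i := fun i => congrFun hab i
  refine covector_ext fun i j hij => ?_
  fin_cases i <;> fin_cases j <;> first
    | exact absurd hij (by decide)
    | exact h 0
    | exact h 1
    | exact h 2
    | exact h 3
    | exact h 4
    | exact h 5

/-- The periods of a 2-form: the coefficients of its average. -/
def period : Form 2 →ₗ[ℝ] Fin 6 → ℝ := coeffs ∘ₗ meanValue

theorem period_eq_zero_iff {α : Form 2} (hα : d 2 α = 0) :
    period α = 0 ↔ α ∈ LinearMap.range (d 1) := by
  constructor
  · intro h
    have h0 : meanValue α = 0 := coeffs_injective (by rw [map_zero]; exact h)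
    have := mean_sub_exact hα
    rw [mean_eq, h0, show const (0 : V [⋀^Fin 2]→L[ℝ] ℝ) = 0 from rfl, zero_sub] at this
    exact neg_mem_iff.1 this
  · rintro ⟨β, rfl⟩
    change coeffs (mean (d 1 β) 0) = 0
    rw [d_mean, TorusField.zero_apply, map_zero]

/-- The periods of the closed forms in `OmegaJ ε J`. -/
def periods (ε : ℝ) (J : AlmostComplex) : Submodule ℝ (Fin 6 → ℝ) :=
  (OmegaJ ε J ⊓ Z2).map period

/-- The exact forms are the kernel of `period` on closed forms, so `period` descends to an injection
of H² that carries `HJ ε J` onto `periods ε J`. -/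
theorem rank_HJ (ε : ℝ) (J : AlmostComplex) :
    Module.rank ℝ (HJ ε J) = Module.rank ℝ (periods ε J) := by
  have hker : B2 = LinearMap.ker (period ∘ₗ Z2.subtype) := by
    ext α
    exact (period_eq_zero_iff α.2).symm
  let Φ : H2 →ₗ[ℝ] Fin 6 → ℝ := B2.liftQ (period ∘ₗ Z2.subtype) hker.le
  have hΦ : Function.Injective Φ := by
    rw [← LinearMap.ker_eq_bot, Submodule.ker_liftQ, ← hker, Submodule.mkQ_map_self]
  have hmap : (HJ ε J).map Φ = periods ε J := by
    rw [HJ, ← Submodule.map_comp, Submodule.liftQ_mkQ, Submodule.map_comp,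
      Submodule.map_comap_subtype, inf_comm]
    rfl
  rw [← hmap]
  exact (Submodule.equivMapOfInjective Φ hΦ (HJ ε J)).rank_eq

theorem mem_periods {ε : ℝ} {J : AlmostComplex} {c : Fin 6 → ℝ} :
    c ∈ periods ε J ↔ ∃ α : Form 2, α ∈ OmegaJ ε J ∧ d 2 α = 0 ∧ period α = c := by
  simp [periods, Submodule.mem_map, and_assoc]

/-! ### Invariant 2-covectors for a block structure -/

theorem dxWedge_apply (i j : Fin 4) (u v : V) :
    dxWedge i j ![u, v] = u i * v j - v i * u j := rfl

theorem covector_apply (a : V [⋀^Fin 2]→L[ℝ] ℝ) (u v : V) :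
    a ![u, v] = a ![e 0, e 1] * (u 0 * v 1 - u 1 * v 0) + a ![e 2, e 3] * (u 2 * v 3 - u 3 * v 2) +
      a ![e 0, e 2] * (u 0 * v 2 - u 2 * v 0) + a ![e 1, e 3] * (u 1 * v 3 - u 3 * v 1) +
      a ![e 0, e 3] * (u 0 * v 3 - u 3 * v 0) + a ![e 1, e 2] * (u 1 * v 2 - u 2 * v 1) := by
  have h : a = a ![e 0, e 1] • dxWedge 0 1 + a ![e 2, e 3] • dxWedge 2 3 +
      a ![e 0, e 2] • dxWedge 0 2 + a ![e 1, e 3] • dxWedge 1 3 +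
      a ![e 0, e 3] • dxWedge 0 3 + a ![e 1, e 2] • dxWedge 1 2 := by
    refine covector_ext fun i j hij => ?_
    fin_cases i <;> fin_cases j <;> first
      | exact absurd hij (by decide)
      | simp [dxWedge_apply]
  conv_lhs => rw [h]
  simp [dxWedge_apply]
  ring

theorem blockEnd_apply (c d : ℝ) (u : V) :
    blockEnd c d u = ![-(c * u 1), c⁻¹ * u 0, -(d * u 3), d⁻¹ * u 2] := by
  ext i
  fin_cases i <;> simp [blockEnd, dx]

/-- Pullback fixes the coefficients 01 and 23 and exchanges 02 with 13 and 03 with 12 up to factors.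
Since ε² = 1, the two equations of each exchanged pair are equivalent, so four conditions suffice.
-/
theorem blockEnd_invariant_iff {c d ε : ℝ} (hc : c ≠ 0) (hd : d ≠ 0) (hε : ε * ε = 1)
    (a : V [⋀^Fin 2]→L[ℝ] ℝ) :
    (∀ u v, a ![blockEnd c d u, blockEnd c d v] = ε * a ![u, v]) ↔
      a ![e 0, e 1] = ε * a ![e 0, e 1] ∧ a ![e 2, e 3] = ε * a ![e 2, e 3] ∧
      a ![e 1, e 3] = ε * (c * d) * a ![e 0, e 2] ∧
      a ![e 1, e 2] = -(ε * (c / d) * a ![e 0, e 3]) := by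
  have key : ∀ u v, a ![blockEnd c d u, blockEnd c d v] =
      a ![e 0, e 1] * (u 0 * v 1 - u 1 * v 0) + a ![e 2, e 3] * (u 2 * v 3 - u 3 * v 2) +
      a ![e 0, e 2] * (c * d) * (u 1 * v 3 - u 3 * v 1) +
      a ![e 1, e 3] / (c * d) * (u 0 * v 2 - u 2 * v 0) -
      a ![e 0, e 3] * (c / d) * (u 1 * v 2 - u 2 * v 1) -
      a ![e 1, e 2] * (d / c) * (u 0 * v 3 - u 3 * v 0) := fun u v => by
    rw [covector_apply, blockEnd_apply, blockEnd_apply]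
    simp
    field_simp
    ring
  constructor
  · intro h
    have h01 := h (e 0) (e 1)
    have h23 := h (e 2) (e 3)
    have h13 := h (e 1) (e 3)
    have h12 := h (e 1) (e 2)
    rw [key] at h01 h23 h13 h12
    simp at h01 h23 h13 h12
    refine ⟨h01, h23, ?_, ?_⟩
    · linear_combination (-ε) * h13 - a ![e 1, e 3] * hε
    · linear_combination (-ε) * h12 - a ![e 1, e 2] * hε
  · rintro ⟨h01, h23, h13, h12⟩ u v
    have h13' : a ![e 1, e 3] / (c * d) = ε * a ![e 0, e 2] := by rw [h13]; field_simp
    have h12' : a ![e 1, e 2] * (d / c) = -(ε * a ![e 0, e 3]) := by rw [h12]; field_simp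
    rw [key, h13', h12', covector_apply a u v]
    linear_combination (u 0 * v 1 - u 1 * v 0) * h01 + (u 2 * v 3 - u 3 * v 2) * h23
      - ε * (u 1 * v 3 - u 3 * v 1) * h13 - ε * (u 1 * v 2 - u 2 * v 1) * h12
      - (a ![e 0, e 2] * (c * d) * (u 1 * v 3 - u 3 * v 1)
        - a ![e 0, e 3] * (c / d) * (u 1 * v 2 - u 2 * v 1)) * hε

/-! ### The deformation -/

/-- The function `exp ((s / 2) (sin 2π(x¹ + x³) - sin 2π(x¹ + x⁴)))`. -/
def cExp (s : ℝ) (x : V) : ℝ :=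
  Real.exp (s / 2 * (Real.sin (2 * Real.pi * (x 0 + x 2)) - Real.sin (2 * Real.pi * (x 0 + x 3))))

/-- The function `exp (-(s / 2) (sin 2π(x¹ + x³) + sin 2π(x¹ + x⁴)))`. -/
def dExp (s : ℝ) (x : V) : ℝ :=
  Real.exp (-(s / 2) *
    (Real.sin (2 * Real.pi * (x 0 + x 2)) + Real.sin (2 * Real.pi * (x 0 + x 3))))

theorem contDiff_blockEnd_exp :
    ContDiff ℝ ∞ fun p : ℝ × V => blockEnd (cExp p.1 p.2) (dExp p.1 p.2) := by
  have hC : ContDiff ℝ ∞ fun p : ℝ × V => cExp p.1 p.2 := by unfold cExp; fun_prop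
  have hD : ContDiff ℝ ∞ fun p : ℝ × V => dExp p.1 p.2 := by unfold dExp; fun_prop
  have hC' := hC.inv fun p => (Real.exp_pos _).ne'
  have hD' := hD.inv fun p => (Real.exp_pos _).ne'
  exact (((hC'.smul contDiff_const).sub (hC.smul contDiff_const)).add
    (hD'.smul contDiff_const)).sub (hD.smul contDiff_const)

theorem contDiff_blockEnd_exp_right (s : ℝ) :
    ContDiff ℝ ∞ fun x : V => blockEnd (cExp s x) (dExp s x) := by
  have h := contDiff_blockEnd_exp.comp
    (contDiff_prodMk_right s : ContDiff ℝ ∞ fun x : V => (s, x))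
  simpa only [Function.comp_def] using h

theorem sin_shift_add (x : V) (n : Fin 4 → ℤ) (j : Fin 4) :
    Real.sin (2 * Real.pi * ((x + fun i => (n i : ℝ)) 0 + (x + fun i => (n i : ℝ)) j)) =
      Real.sin (2 * Real.pi * (x 0 + x j)) := by
  rw [← sin_shift (x 0 + x j) (n 0 + n j)]
  simp only [Pi.add_apply]
  push_cast
  ring_nf

/-- The family of almost complex structures through `J₀` that interpolates the `J_k`. -/
def family (s : ℝ) : AlmostComplex :=
  ⟨⟨fun x => blockEnd (cExp s x) (dExp s x),
    contDiff_blockEnd_exp_right s, fun n x => by simp only [cExp, dExp, sin_shift_add]⟩,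
    fun _ => blockEnd_comp (Real.exp_pos _).ne' (Real.exp_pos _).ne'⟩

theorem family_apply (s : ℝ) (x : V) : (family s).1 x = blockEnd (cExp s x) (dExp s x) := rfl

theorem family_zero : family 0 = J0 := by
  refine Subtype.ext (TorusField.ext fun x => ?_)
  rw [family_apply]
  simp [cExp, dExp, J0]

theorem J_eq_family (k : ℕ) : J k = family (1 / k) := by
  refine Subtype.ext (TorusField.ext fun x => ?_)
  rw [family_apply]
  change blockEnd (C k x) (D k x) = _
  congr 1
  · rw [C, A, B, ← Real.exp_sub, ← Real.exp_half, cExp]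
    ring_nf
  · rw [D, A, B, ← Real.exp_add, one_div, ← Real.exp_neg, ← Real.exp_half, dExp]
    ring_nf

theorem isCompatible_family (s : ℝ) : IsCompatible omega0 (family s) := by
  have hc : ∀ x, 0 < cExp s x := fun x => Real.exp_pos _
  have hd : ∀ x, 0 < dExp s x := fun x => Real.exp_pos _
  constructor
  · intro x u hu
    have h : omega0 x ![u, (family s).1 x u] = (cExp s x)⁻¹ * u 0 ^ 2 + cExp s x * u 1 ^ 2 +
        (dExp s x)⁻¹ * u 2 ^ 2 + dExp s x * u 3 ^ 2 := by
      rw [family_apply, blockEnd_apply]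
      simp [omega0, dxWedge_apply]
      ring
    rw [h]
    have hc' := inv_pos.2 (hc x)
    have hd' := inv_pos.2 (hd x)
    have hcx := hc x
    have hdx := hd x
    obtain ⟨i, hi⟩ := Function.ne_iff.1 hu
    have hi : u i ≠ 0 := hi
    fin_cases i <;> simp at hi <;> positivity
  · intro x u v
    have := (blockEnd_invariant_iff (ε := 1) (hc x).ne' (hd x).ne' (by norm_num) (omega0 x)).2
      (by simp [omega0, dxWedge_apply]) u v
    rwa [one_mul] at this

/-! ### Continuity of the deformation -/

/-- The x-derivatives are jointly continuous in (s, x), hence converge uniformly on the compact unit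
cube, and periodicity extends this to all of ℝ⁴. -/
theorem continuous_of_contDiff_uncurry {F : Type} [NormedAddCommGroup F] [NormedSpace ℝ F]
    {G : ℝ × V → F} (hG : ContDiff ℝ ∞ G) {φ : ℝ → TorusField F}
    (hφ : ∀ s x, φ s x = G (s, x)) : Continuous φ := by
  refine continuous_iff_continuousAt.2 fun s => TorusField.tendsto_iff.2 fun m => ?_
  have hder : ∀ t x, iteratedFDeriv ℝ m (φ t) x =
      (iteratedFDeriv ℝ m G (t, x)).compContinuousLinearMap
        fun _ => ContinuousLinearMap.inr ℝ ℝ V := by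
    intro t x
    have h1 : (φ t : V → F) = (fun p => G ((t, 0) + p)) ∘ ContinuousLinearMap.inr ℝ ℝ V := by
      funext y
      simp [hφ]
    have h2 : ContDiff ℝ ∞ fun p => G ((t, 0) + p) := by fun_prop
    rw [h1, ContinuousLinearMap.iteratedFDeriv_comp_right _ h2 x (i := m)
      (by exact_mod_cast le_top), iteratedFDeriv_comp_add_left]
    simp
  have hcont : Continuous fun p : ℝ × V => iteratedFDeriv ℝ m (φ p.1) p.2 := by
    simp only [hder]
    exact (ContinuousMultilinearMap.compContinuousLinearMapL
      fun _ => ContinuousLinearMap.inr ℝ ℝ V).continuous.comp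
      (hG.continuous_iteratedFDeriv (by exact_mod_cast le_top))
  have hper : ∀ t, IsPeriodic (iteratedFDeriv ℝ m (φ t)) := by
    intro t n x
    have h : (fun y => φ t (y + fun i => (n i : ℝ))) = φ t :=
      funext fun y => (φ t).periodic n y
    rw [← iteratedFDeriv_comp_add_right, h]
  have hunif := Continuous.tendstoUniformly
    (fun (t : ℝ) (x : Set.Icc (0 : V) 1) => iteratedFDeriv ℝ m (φ t) x)
    (hcont.comp (continuous_fst.prodMk (continuous_subtype_val.comp continuous_snd))) s
  intro U hU
  filter_upwards [hunif U hU] with t ht x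
  -- Subtracting integer parts moves any point into the cube.
  have hmem : x + (fun i => ((-⌊x i⌋ : ℤ) : ℝ)) ∈ Set.Icc (0 : V) 1 := by
    constructor <;> intro i <;> simp
    · linarith [Int.floor_le (x i)]
    · linarith [Int.lt_floor_add_one (x i)]
  have := ht ⟨_, hmem⟩
  rwa [hper, hper] at this

theorem continuous_family : Continuous family :=
  (continuous_of_contDiff_uncurry contDiff_blockEnd_exp fun _ _ => rfl).subtype_mk _

theorem continuous_metricOf_family : Continuous fun s => metricOf omega0 (family s) := by
  refine continuous_of_contDiff_uncurry
    (G := fun p => (toBilin (dxWedge 0 1 + dxWedge 2 3)).bilinearComp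
      (ContinuousLinearMap.id ℝ V) (blockEnd (cExp p.1 p.2) (dExp p.1 p.2))) ?_ fun _ _ => rfl
  refine contDiff_clm_apply_iff.2 fun u => contDiff_clm_apply_iff.2 fun v => ?_
  have h := contDiff_blockEnd_exp.clm_apply (contDiff_const (c := v))
  have h' := (toBilin (dxWedge 0 1 + dxWedge 2 3) u).contDiff.comp h
  simpa only [Function.comp_def, ContinuousLinearMap.bilinearComp_apply,
    ContinuousLinearMap.id_apply] using h'

theorem g0_eq : g0 = metricOf omega0 J0 := by
  refine TorusField.ext fun x => ContinuousLinearMap.ext fun u => ContinuousLinearMap.ext fun v => ?_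
  rw [metricOf_apply, ← family_zero, family_apply, blockEnd_apply]
  simp [g0, omega0, dxWedge_apply, dx, cExp, dExp, Fin.sum_univ_four]
  ring

theorem coAct_blockEnd {J : AlmostComplex} {c d : ℝ} {x : V} (h : J.1 x = blockEnd c d) :
    coAct J x (dx 0) = c • dx 1 ∧ coAct J x (dx 1) = -(1 / c) • dx 0 ∧
      coAct J x (dx 2) = d • dx 3 ∧ coAct J x (dx 3) = -(1 / d) • dx 2 := by
  refine ⟨?_, ?_, ?_, ?_⟩ <;> ext1 u <;> simp only [coAct, h] <;>
    simp [dx, blockEnd_apply]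

/-! ### A Cauchy–Riemann system on the torus -/

namespace TorusField

instance : Mul (TorusField ℝ) :=
  ⟨fun f g => ⟨fun x => f x * g x, f.contDiff.mul g.contDiff, fun n x => by
    simp only [f.periodic n x, g.periodic n x]⟩⟩

@[simp] theorem mul_apply (f g : TorusField ℝ) (x : V) : (f * g) x = f x * g x := rfl

theorem pd_mul (v : V) (f g : TorusField ℝ) : pd v (f * g) = pd v f * g + f * pd v g := by
  refine TorusField.ext fun x => ?_
  have h := ((f.hasFDerivAt x).mul (g.hasFDerivAt x)).fderiv
  change fderiv ℝ (fun x => f x * g x) x v = _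
  change fderiv ℝ (fun x => f x * g x) x = _ at h
  rw [h]
  simp [pd_apply, deriv_apply]
  ring

theorem pd_comm (u v : V) (f : TorusField ℝ) : pd u (pd v f) = pd v (pd u f) := by
  refine TorusField.ext fun x => ?_
  have h := ((contDiff_infty.1 f.contDiff 2).contDiffAt (x := x)).isSymmSndFDerivAt (by simp)
  change pd u (map _ (deriv f)) x = pd v (map _ (deriv f)) x
  rw [pd_map, pd_map]
  exact h u v

theorem apply_add_smul_of_pd_eq_zero {f : TorusField ℝ} {v : V} (h : pd v f = 0) (x : V) (t : ℝ) :
    f (x + t • v) = f x := by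
  have h0 : ∀ t, HasDerivAt (fun t : ℝ => f (x + t • v)) 0 t := fun t => by
    simpa [h] using f.hasDerivAt_segment v x t
  have := is_const_of_deriv_eq_zero (fun t => (h0 t).differentiableAt) (fun t => (h0 t).deriv) t 0
  simpa using this

/-- A generalised Cauchy–Riemann system on `𝕋²` has only constant solutions. -/
theorem pd_eq_zero_of_cauchyRiemann {i j : Fin 4} {f h : TorusField ℝ} {W : V → ℝ}
    (hW : ∀ x, 0 < W x) (h1 : ∀ x, pd (e i) f x = -(W x * pd (e j) h x))
    (h2 : ∀ x, pd (e j) f x = pd (e i) h x) :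
    pd (e i) f = 0 ∧ pd (e j) f = 0 ∧ pd (e i) h = 0 ∧ pd (e j) h = 0 := by
  -- Energy identity: the second derivatives of `h` cancel, so a divergence equals a weighted sum of
  -- squares.
  have hN : ∀ x, (pd (e j) (f * pd (e i) h) - pd (e i) (f * pd (e j) h)) x =
      W x * pd (e j) h x ^ 2 + pd (e i) h x ^ 2 := fun x => by
    rw [pd_mul, pd_mul, pd_comm (e j) (e i)]
    simp only [sub_apply, add_apply, mul_apply, h1, h2]
    ring
  have hN0 : ∀ x, 0 ≤ (pd (e j) (f * pd (e i) h) - pd (e i) (f * pd (e j) h)) x := fun x => by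
    rw [hN]
    have := hW x
    positivity
  -- Each divergence term dies under the average in its own direction, so averaging over the (i,
  -- j)-torus alone gives zero.
  have hz := eq_zero_of_avg_eq_zero hN0 (v := e i) (eq_zero_of_avg_eq_zero (v := e j)
    (avg_nonneg hN0 (e i)) (by
      rw [map_sub, avg_pd, avg, ← pd_wavg, sub_zero, avg_pd]))
  have hh : ∀ x, pd (e j) h x = 0 ∧ pd (e i) h x = 0 := fun x => by
    have h0 := hN x
    rw [hz, TorusField.zero_apply] at h0
    have hWx := hW x
    have ha : 0 ≤ W x * pd (e j) h x ^ 2 := by positivity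
    have hb : 0 ≤ pd (e i) h x ^ 2 := by positivity
    have hb' : pd (e i) h x ^ 2 = 0 := by linarith
    have ha' : W x * pd (e j) h x ^ 2 = 0 := by linarith
    exact ⟨by simpa [hWx.ne'] using ha', by simpa using hb'⟩
  refine ⟨TorusField.ext fun x => ?_, TorusField.ext fun x => ?_, TorusField.ext fun x => (hh x).2,
    TorusField.ext fun x => (hh x).1⟩
  · rw [h1, (hh x).1]; simp
  · rw [h2, (hh x).2]; simp

end TorusField

/-! ### Plane waves -/

/-- The function `x ↦ U (x¹ + xʲ)`, for a smooth function `U` of period `1`. -/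
def wave (j : Fin 4) {U : ℝ → ℝ} (hU : ContDiff ℝ ∞ U) (hp : Function.Periodic U 1) :
    TorusField ℝ :=
  ⟨fun x => U (x 0 + x j), hU.comp (by fun_prop), fun n x => by
    have h := (hp.int_mul (n 0 + n j)) (x 0 + x j)
    simp only [Pi.add_apply]
    rw [← h]
    push_cast
    ring_nf⟩

section wave

variable {U : ℝ → ℝ} (hU : ContDiff ℝ ∞ U) (hp : Function.Periodic U 1) (j : Fin 4)

theorem wave_apply (x : V) : wave j hU hp x = U (x 0 + x j) := rfl

theorem pd_wave (v x : V) : pd v (wave j hU hp) x = _root_.deriv U (x 0 + x j) * (v 0 + v j) := by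
  have h1 : HasFDerivAt (fun x : V => x 0 + x j) (dx 0 + dx j) x :=
    (dx 0 + dx j).hasFDerivAt
  have h2 := ((hU.differentiable (by simp)) (x 0 + x j)).hasDerivAt.comp_hasFDerivAt x h1
  change fderiv ℝ (fun x : V => U (x 0 + x j)) x v = _
  change HasFDerivAt (fun x : V => U (x 0 + x j)) _ x at h2
  rw [h2.fderiv]
  simp [dx, mul_add]

/-- The closed 2-form `U (x¹ + xʲ) (dx¹ + dxʲ) ∧ dxⁱ`. -/
def waveForm (i : Fin 4) : Form 2 :=
  map ((ContinuousLinearMap.id ℝ ℝ).smulRight (dxWedge 0 i + dxWedge j i)) (wave j hU hp)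

theorem waveForm_apply (i : Fin 4) (x u v : V) : waveForm hU hp j i x ![u, v] =
    U (x 0 + x j) * (u 0 * v i - v 0 * u i + (u j * v i - v j * u i)) := rfl

theorem d_waveForm (i : Fin 4) : d 2 (waveForm hU hp j i) = 0 := by
  refine TorusField.ext fun x => ContinuousAlternatingMap.ext fun m => ?_
  obtain ⟨u, v, w, rfl⟩ : ∃ u v w, m = ![u, v, w] :=
    ⟨m 0, m 1, m 2, by ext i; fin_cases i <;> rfl⟩
  rw [d_two_apply, waveForm]
  simp only [pd_map, map_apply, pd_wave]
  change _root_.deriv U (x 0 + x j) * (u 0 + u j) * (dxWedge 0 i ![v, w] + dxWedge j i ![v, w]) -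
    _root_.deriv U (x 0 + x j) * (v 0 + v j) * (dxWedge 0 i ![u, w] + dxWedge j i ![u, w]) +
    _root_.deriv U (x 0 + x j) * (w 0 + w j) * (dxWedge 0 i ![u, v] + dxWedge j i ![u, v]) = (0 : ℝ)
  simp only [dxWedge_apply]
  ring

theorem period_waveForm (i : Fin 4) : period (waveForm hU hp j i) =
    meanValue (wave j hU hp) • coeffs (dxWedge 0 i + dxWedge j i) := by
  rw [period, LinearMap.comp_apply, waveForm, meanValue_map, ← map_smul]
  rfl

end wave

/-- The profile `exp (s sin 2πt)`. -/
def profile (s t : ℝ) : ℝ := Real.exp (s * Real.sin (2 * Real.pi * t))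

theorem profile_contDiff (s : ℝ) : ContDiff ℝ ∞ (profile s) := by unfold profile; fun_prop

theorem profile_periodic (s : ℝ) : Function.Periodic (profile s) 1 := fun t => by
  have := sin_shift t 1
  rw [Int.cast_one] at this
  rw [profile, profile, this]

theorem profile_pos (s t : ℝ) : 0 < profile s t := Real.exp_pos _

theorem profile_mul_neg (s t : ℝ) : profile s t * profile (-s) t = 1 := by
  rw [profile, profile, ← Real.exp_add, neg_mul, add_neg_cancel, Real.exp_zero]

theorem deriv_profile (s t : ℝ) : _root_.deriv (profile s) t =
    profile s t * (s * (Real.cos (2 * Real.pi * t) * (2 * Real.pi))) := by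
  have h := (((((hasDerivAt_id t).const_mul (2 * Real.pi)).sin).const_mul s).exp).deriv
  simpa [profile, show profile s = fun t => _ from rfl] using h

/-- The function `exp (s sin 2π(x¹ + xʲ))`. -/
abbrev expWave (j : Fin 4) (s : ℝ) : TorusField ℝ :=
  wave j (profile_contDiff s) (profile_periodic s)

/-- Moving in direction j changes the phase of the wave but not `f`, `∂₀f` or `r`, so one linear
relation between these values holds at every phase. -/
theorem eq_zero_of_pd_expWave_mul {s : ℝ} (hs : s ≠ 0) {j : Fin 4} (hj : j ≠ 0)
    {f r : TorusField ℝ} (hf : pd (e j) f = 0) (hr : pd (e j) r = 0)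
    (h : pd (e 0) (expWave j s * f) = r) : f = 0 := by
  have hf0 : pd (e j) (pd (e 0) f) = 0 := by rw [pd_comm, hf, map_zero]
  refine TorusField.ext fun x => ?_
  have key : ∀ τ : ℝ, _root_.deriv (profile s) τ * f x + profile s τ * pd (e 0) f x = r x := fun τ => by
    -- The translation is chosen so that the phase x⁰ + xʲ becomes τ.
    have hτ := congrArg (fun g : TorusField ℝ => g (x + (τ - x 0 - x j) • e j)) h
    simp only [pd_mul, TorusField.add_apply, TorusField.mul_apply, pd_wave, wave_apply,
      apply_add_smul_of_pd_eq_zero hf, apply_add_smul_of_pd_eq_zero hf0,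
      apply_add_smul_of_pd_eq_zero hr] at hτ
    simpa [hj, hj.symm] using hτ
  -- At phases 0 and 1/2 the profile equals 1 and its slopes are ±2πs; subtracting leaves 4πs·f = 0.
  have h0 := key 0
  have h1 := key (1 / 2)
  have e1 : 2 * Real.pi * (1 / 2) = Real.pi := by ring
  simp only [deriv_profile, profile, e1] at h0 h1
  simp at h0 h1
  have h2 : 4 * Real.pi * s * f x = 0 := by linarith
  simpa [hs, Real.pi_ne_zero] using h2

/-- Equality case of Cauchy–Schwarz: for a wave E with mean m and mm' = 1, the nonnegative function
(E - m)²/E = E - 2m + m²/E has mean m(mm' - 1) = 0. Then E is constant, against its values 1 and exp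
s at phases 0 and 1/4. -/
theorem meanValue_expWave_mul_ne_one {s : ℝ} (hs : s ≠ 0) {j : Fin 4} (hj : j ≠ 0) :
    meanValue (expWave j s) * meanValue (expWave j (-s)) ≠ 1 := by
  intro h
  set m := meanValue (expWave j s) with hm
  set m' := meanValue (expWave j (-s)) with hm'
  let N : TorusField ℝ := expWave j s - TorusField.const (2 * m) + m ^ 2 • expWave j (-s)
  have hN : ∀ x, N x = (profile s (x 0 + x j) - m) ^ 2 * profile (-s) (x 0 + x j) := fun x => by
    change profile s (x 0 + x j) - 2 * m + m ^ 2 * profile (-s) (x 0 + x j) = _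
    linear_combination (2 * m - profile s (x 0 + x j)) * profile_mul_neg s (x 0 + x j)
  have hN0 : N = 0 := by
    refine eq_zero_of_meanValue_eq_zero (fun x => ?_) ?_
    · rw [hN]
      have := profile_pos (-s) (x 0 + x j)
      positivity
    · simp only [N, map_add, map_sub, map_smul, meanValue_const, ← hm, ← hm', smul_eq_mul]
      linear_combination m * h
  have hc : ∀ τ, profile s τ = m := fun τ => by
    have h0 := hN (τ • e 0)
    rw [hN0] at h0
    simp [hj] at h0
    have := (profile_pos (-s) τ).ne'
    rcases h0 with h0 | h0
    · linarith
    · exact absurd h0 this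
  have h4 := (hc (1 / 4)).trans (hc 0).symm
  have e4 : 2 * Real.pi * (1 / 4) = Real.pi / 2 := by ring
  simp only [profile, e4, Real.sin_pi_div_two, mul_zero, Real.sin_zero, Real.exp_zero, mul_one,
    Real.exp_eq_one_iff] at h4
  exact hs h4

/-- The coefficient function `α(∂ᵢ, ∂ⱼ)`. -/
def coeff (i j : Fin 4) : Form 2 →ₗ[ℝ] TorusField ℝ := map (ev (e i) (e j))

theorem coeff_apply (i j : Fin 4) (α : Form 2) (x : V) : coeff i j α x = α x ![e i, e j] :=
  ev_apply _ _ _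

theorem meanValue_coeff (i j : Fin 4) (α : Form 2) :
    meanValue (coeff i j α) = meanValue α ![e i, e j] := by
  rw [coeff, meanValue_map, ev_apply]

/-! ### Closed forms of pure type for the deformed structures -/

theorem mem_OmegaJ_of_blockEnd {J : AlmostComplex} {c d : V → ℝ}
    (hJ : ∀ x, J.1 x = blockEnd (c x) (d x)) (hc : ∀ x, c x ≠ 0) (hd : ∀ x, d x ≠ 0) {ε : ℝ}
    (hε : ε * ε = 1) {α : Form 2} : α ∈ OmegaJ ε J ↔ ∀ x,
      coeff 0 1 α x = ε * coeff 0 1 α x ∧ coeff 2 3 α x = ε * coeff 2 3 α x ∧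
      coeff 1 3 α x = ε * (c x * d x) * coeff 0 2 α x ∧
      coeff 1 2 α x = -(ε * (c x / d x) * coeff 0 3 α x) := by
  simp only [coeff_apply]
  refine forall_congr' fun x => ?_
  rw [← blockEnd_invariant_iff (hc x) (hd x) hε (α x), hJ x]

theorem cExp_mul_dExp (s : ℝ) (x : V) : cExp s x * dExp s x = expWave 3 (-s) x := by
  change _ = Real.exp _
  rw [cExp, dExp, ← Real.exp_add]
  ring_nf

theorem cExp_div_dExp (s : ℝ) (x : V) : cExp s x / dExp s x = expWave 2 s x := by
  change _ = Real.exp _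
  rw [cExp, dExp, ← Real.exp_sub]
  ring_nf

theorem mem_OmegaJ_family {s ε : ℝ} (hε : ε * ε = 1) {α : Form 2} :
    α ∈ OmegaJ ε (family s) ↔ ∀ x,
      coeff 0 1 α x = ε * coeff 0 1 α x ∧ coeff 2 3 α x = ε * coeff 2 3 α x ∧
      coeff 1 3 α x = ε * expWave 3 (-s) x * coeff 0 2 α x ∧
      coeff 1 2 α x = -(ε * expWave 2 s x * coeff 0 3 α x) := by
  simp only [← cExp_mul_dExp, ← cExp_div_dExp]
  exact mem_OmegaJ_of_blockEnd (family_apply s) (fun x => (Real.exp_pos _).ne')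
    (fun x => (Real.exp_pos _).ne') hε

theorem pd_coeff_of_closed {α : Form 2} (hα : d 2 α = 0) (i j k : Fin 4) :
    pd (e i) (coeff j k α) - pd (e j) (coeff i k α) + pd (e k) (coeff i j α) = 0 := by
  refine TorusField.ext fun x => ?_
  have h := d_two_apply α x (e i) (e j) (e k)
  rw [hα] at h
  simp only [coeff, pd_map, TorusField.add_apply, TorusField.sub_apply, map_apply, ev_apply]
  exact h.symm

theorem pd_expWave_of_ne {j i : Fin 4} (h0 : i ≠ 0) (hj : i ≠ j) (s : ℝ) :
    pd (e i) (expWave j s) = 0 := by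
  refine TorusField.ext fun x => ?_
  rw [pd_wave]
  simp [h0.symm, hj.symm]

/-- The forms themselves vanish, not only their classes. -/
theorem eq_zero_of_mem_OmegaJ_family {s : ℝ} (hs : s ≠ 0) {α : Form 2}
    (hα : α ∈ OmegaJ (-1) (family s)) (hd : d 2 α = 0) : α = 0 := by
  rw [mem_OmegaJ_family (by norm_num)] at hα
  have h01 : coeff 0 1 α = 0 := TorusField.ext fun x => by
    rw [TorusField.zero_apply]; linarith [(hα x).1]
  have h23 : coeff 2 3 α = 0 := TorusField.ext fun x => by
    rw [TorusField.zero_apply]; linarith [(hα x).2.1]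
  have h13 : coeff 1 3 α = -(expWave 3 (-s) * coeff 0 2 α) := TorusField.ext fun x => by
    rw [(hα x).2.2.1, TorusField.neg_apply, TorusField.mul_apply]; ring
  have h12 : coeff 1 2 α = expWave 2 s * coeff 0 3 α := TorusField.ext fun x => by
    rw [(hα x).2.2.2, TorusField.mul_apply]; ring
  have d012 := pd_coeff_of_closed hd 0 1 2
  have d013 := pd_coeff_of_closed hd 0 1 3
  have d023 := pd_coeff_of_closed hd 0 2 3
  have d123 := pd_coeff_of_closed hd 1 2 3
  rw [h01, h12, map_zero, add_zero, sub_eq_zero] at d012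
  rw [h01, h13, map_zero, add_zero, sub_eq_zero] at d013
  rw [h23, map_zero, zero_sub, neg_add_eq_zero] at d023
  rw [h23, h13, h12, map_zero, map_neg, zero_sub, neg_neg] at d123
  set f := coeff 0 2 α
  set h := coeff 0 3 α
  rw [pd_mul, pd_mul, pd_expWave_of_ne (by decide) (by decide),
    pd_expWave_of_ne (by decide) (by decide)] at d123
  -- Since 1/B does not involve x² and A does not involve x³, the 123-component reads ∂₂f/B + A∂₃h =
  -- 0; multiplying by B gives the weight W = BA. The 023-component is ∂₃f = ∂₂h.
  obtain ⟨hf2, hf3, hh2, hh3⟩ := pd_eq_zero_of_cauchyRiemann (i := 2) (j := 3) (f := f) (h := h)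
    (W := fun x => profile s (x 0 + x 3) * profile s (x 0 + x 2))
    (fun x => mul_pos (profile_pos _ _) (profile_pos _ _))
    (fun x => by
      have := congrArg (fun g : TorusField ℝ => g x) d123
      simp only [TorusField.add_apply, TorusField.mul_apply, TorusField.zero_apply, zero_mul,
        zero_add, wave_apply] at this
      linear_combination profile s (x 0 + x 3) * this -
        pd (e 2) f x * profile_mul_neg s (x 0 + x 3))
    (fun x => congrArg (fun g : TorusField ℝ => g x) d023.symm)
  -- The 012-component is ∂₀(Ah) = ∂₁f, whose right side is independent of x². Once h = 0, the
  -- 013-component becomes ∂₀(f/B) = 0.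
  have hh : h = 0 := eq_zero_of_pd_expWave_mul hs (j := 2) (by decide) hh2
    (by rw [pd_comm, hf2, map_zero]) d012
  have hf : f = 0 := eq_zero_of_pd_expWave_mul (neg_ne_zero.2 hs) (j := 3) (by decide) hf3
    (r := 0) (map_zero _) (by rw [hh, map_zero, map_neg, neg_eq_zero] at d013; exact d013)
  have key : ∀ {i j} (x : V), coeff i j α = 0 → α x ![e i, e j] = 0 := fun x h0 => by
    rw [← coeff_apply, h0, TorusField.zero_apply]
  refine TorusField.ext fun x => coeffs_injective ?_
  have hf12 : coeff 1 2 α = 0 := by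
    rw [h12, hh]; exact TorusField.ext fun x => mul_zero _
  have hf13 : coeff 1 3 α = 0 := by
    rw [h13, hf]; exact TorusField.ext fun x => by simp
  ext i
  fin_cases i
  · exact key x h01
  · exact key x h23
  · exact key x hf
  · exact key x hf13
  · exact key x hh
  · exact key x hf12

theorem hMinus_family {s : ℝ} (hs : s ≠ 0) : hMinus (family s) = 0 := by
  have h : periods (-1) (family s) = ⊥ := by
    refine (Submodule.eq_bot_iff _).2 fun c hc => ?_
    obtain ⟨α, hα, hd, rfl⟩ := mem_periods.1 hc
    rw [eq_zero_of_mem_OmegaJ_family hs hα hd, map_zero]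
  rw [hMinus, rank_HJ, h, rank_bot]

theorem period_const (a : V [⋀^Fin 2]→L[ℝ] ℝ) : period (TorusField.const a) = coeffs a := by
  rw [period, LinearMap.comp_apply, meanValue_const]

theorem coeffs_apply (a : V [⋀^Fin 2]→L[ℝ] ℝ) : coeffs a = ![a ![e 0, e 1], a ![e 2, e 3],
    a ![e 0, e 2], a ![e 1, e 3], a ![e 0, e 3], a ![e 1, e 2]] := rfl

theorem const_mem_periods {ε s : ℝ} {a : V [⋀^Fin 2]→L[ℝ] ℝ}
    (h : TorusField.const a ∈ OmegaJ ε (family s)) : coeffs a ∈ periods ε (family s) :=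
  mem_periods.2 ⟨_, h, d_const a, period_const a⟩

theorem one_contDiff : ContDiff ℝ ∞ fun _ : ℝ => (1 : ℝ) := contDiff_const

theorem one_periodic : Function.Periodic (fun _ : ℝ => (1 : ℝ)) 1 := fun _ => rfl

theorem wave_one (j : Fin 4) : wave j one_contDiff one_periodic = TorusField.const 1 := rfl

theorem periods_family {s : ℝ} (hs : s ≠ 0) : periods 1 (family s) = ⊤ := by
  have hm := fun α : Form 2 => mem_OmegaJ_family (s := s) (ε := 1) (by norm_num) (α := α)
  have v0 : ![1, 0, 0, 0, 0, 0] ∈ periods 1 (family s) := by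
    have := const_mem_periods (a := dxWedge 0 1) ((hm _).2 fun x => by
      simp [coeff_apply, dxWedge_apply])
    simpa [coeffs_apply, dxWedge_apply] using this
  have v1 : ![0, 1, 0, 0, 0, 0] ∈ periods 1 (family s) := by
    have := const_mem_periods (a := dxWedge 2 3) ((hm _).2 fun x => by
      simp [coeff_apply, dxWedge_apply])
    simpa [coeffs_apply, dxWedge_apply] using this
  have hcl : ∀ {α β : Form 2}, d 2 α = 0 → d 2 β = 0 → d 2 (α - β) = 0 := fun h1 h2 => by
    rw [map_sub, h1, h2, sub_zero]
  have hcl' : ∀ {α β : Form 2}, d 2 α = 0 → d 2 β = 0 → d 2 (α + β) = 0 := fun h1 h2 => by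
    rw [map_add, h1, h2, add_zero]
  set m := meanValue (expWave 3 s) with hm1
  set m' := meanValue (expWave 3 (-s)) with hm2
  set n := meanValue (expWave 2 s) with hn1
  set n' := meanValue (expWave 2 (-s)) with hn2
  -- The form (dx⁰+dx³)∧(dx² - B⁻¹dx¹); `v3` comes from B times it. Each term stays closed because a
  -- function of x⁰+x³ multiplies dx⁰+dx³.
  have v2 : ![-m', -1, 1, m', 0, 0] ∈ periods 1 (family s) := by
    refine mem_periods.2 ⟨waveForm one_contDiff one_periodic 3 2 -
      waveForm (profile_contDiff (-s)) (profile_periodic (-s)) 3 1, (hm _).2 fun x => ?_,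
      hcl (d_waveForm _ _ _ _) (d_waveForm _ _ _ _), ?_⟩
    · simp [coeff_apply, waveForm_apply, wave_apply]
    · rw [map_sub, period_waveForm, period_waveForm, wave_one, meanValue_const, ← hm2]
      ext i
      fin_cases i <;> simp [coeffs_apply, dxWedge_apply]
  have v3 : ![-1, -m, m, 1, 0, 0] ∈ periods 1 (family s) := by
    refine mem_periods.2 ⟨waveForm (profile_contDiff s) (profile_periodic s) 3 2 -
      waveForm one_contDiff one_periodic 3 1, (hm _).2 fun x => ?_,
      hcl (d_waveForm _ _ _ _) (d_waveForm _ _ _ _), ?_⟩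
    · have := profile_mul_neg s (x 0 + x 3)
      simp [coeff_apply, waveForm_apply, wave_apply]
      linarith
    · rw [map_sub, period_waveForm, period_waveForm, wave_one, meanValue_const, ← hm1]
      ext i
      fin_cases i <;> simp [coeffs_apply, dxWedge_apply]
  -- The form (dx⁰+dx²)∧(A dx¹ + dx³), with phase x⁰+x²; `v5` comes from A⁻¹ times it.
  have v4 : ![n, 1, 0, 0, 1, -n] ∈ periods 1 (family s) := by
    refine mem_periods.2 ⟨waveForm (profile_contDiff s) (profile_periodic s) 2 1 +
      waveForm one_contDiff one_periodic 2 3, (hm _).2 fun x => ?_,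
      hcl' (d_waveForm _ _ _ _) (d_waveForm _ _ _ _), ?_⟩
    · simp [coeff_apply, waveForm_apply, wave_apply]
    · rw [map_add, period_waveForm, period_waveForm, wave_one, meanValue_const, ← hn1]
      simp [coeffs_apply, dxWedge_apply]
  have v5 : ![1, n', 0, 0, n', -1] ∈ periods 1 (family s) := by
    refine mem_periods.2 ⟨waveForm one_contDiff one_periodic 2 1 +
      waveForm (profile_contDiff (-s)) (profile_periodic (-s)) 2 3, (hm _).2 fun x => ?_,
      hcl' (d_waveForm _ _ _ _) (d_waveForm _ _ _ _), ?_⟩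
    · have := profile_mul_neg s (x 0 + x 2)
      simp [coeff_apply, waveForm_apply, wave_apply]
      linarith
    · rw [map_add, period_waveForm, period_waveForm, wave_one, meanValue_const, ← hn2]
      simp [coeffs_apply, dxWedge_apply]
  have hΔ : 1 - m * m' ≠ 0 := sub_ne_zero.2 (meanValue_expWave_mul_ne_one hs (by decide)).symm
  have hΔ' : 1 - n * n' ≠ 0 := sub_ne_zero.2 (meanValue_expWave_mul_ne_one hs (by decide)).symm
  refine (Submodule.eq_top_iff').2 fun c => ?_
  -- Cramer's rule in two 2×2 blocks: `v2`, `v3` span coordinates 2 and 3, and `v4`, `v5` span 4 and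
  -- 5, with determinants 1 - mm' and -(1 - nn'). Then `v0`, `v1` correct coordinates 0 and 1.
  set a := (c 2 - m * c 3) / (1 - m * m') with ha
  set b := (c 3 - m' * c 2) / (1 - m * m') with hb
  set a' := (c 4 + n' * c 5) / (1 - n * n')
  set b' := -(c 5 + n * c 4) / (1 - n * n')
  have h4 : a' * (1 - n * n') = c 4 + n' * c 5 := div_mul_cancel₀ _ hΔ'
  have h5 : b' * (1 - n * n') = -(c 5 + n * c 4) := div_mul_cancel₀ _ hΔ'
  have hc : c = (c 0 + a * m' + b - a' * n - b') • ![1, 0, 0, 0, 0, 0] +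
      (c 1 + a + b * m - a' - b' * n') • ![0, 1, 0, 0, 0, 0] + a • ![-m', -1, 1, m', 0, 0] +
      b • ![-1, -m, m, 1, 0, 0] + a' • ![n, 1, 0, 0, 1, -n] + b' • ![1, n', 0, 0, n', -1] := by
    ext i
    fin_cases i <;> simp
    · ring
    · ring
    · rw [ha, hb]; field_simp; ring
    · rw [ha, hb]; field_simp; ring
    · exact mul_right_cancel₀ hΔ' (by linear_combination -h4 - n' * h5)
    · exact mul_right_cancel₀ hΔ' (by linear_combination n * h4 + h5)
  rw [hc]
  exact add_mem (add_mem (add_mem (add_mem (add_mem (Submodule.smul_mem _ _ v0)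
    (Submodule.smul_mem _ _ v1)) (Submodule.smul_mem _ _ v2)) (Submodule.smul_mem _ _ v3))
    (Submodule.smul_mem _ _ v4)) (Submodule.smul_mem _ _ v5)

theorem hPlus_family {s : ℝ} (hs : s ≠ 0) : hPlus (family s) = 6 := by
  rw [hPlus, rank_HJ, periods_family hs, rank_top, rank_fin_fun]
  rfl

/-! ### The standard structure -/

theorem mem_OmegaJ_J0 {ε : ℝ} (hε : ε * ε = 1) {α : Form 2} : α ∈ OmegaJ ε J0 ↔ ∀ x,
    coeff 0 1 α x = ε * coeff 0 1 α x ∧ coeff 2 3 α x = ε * coeff 2 3 α x ∧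
    coeff 1 3 α x = ε * coeff 0 2 α x ∧ coeff 1 2 α x = -(ε * coeff 0 3 α x) := by
  rw [mem_OmegaJ_of_blockEnd (c := 1) (d := 1) (fun _ => rfl) (fun _ => one_ne_zero)
    (fun _ => one_ne_zero) hε]
  simp

/-- The pointwise conditions have constant coefficients, so they pass to averages; conversely a
constant form realises every solution. -/
theorem mem_periods_J0 {ε : ℝ} (hε : ε * ε = 1) {c : Fin 6 → ℝ} : c ∈ periods ε J0 ↔
    c 0 = ε * c 0 ∧ c 1 = ε * c 1 ∧ c 3 = ε * c 2 ∧ c 5 = -(ε * c 4) := by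
  constructor
  · intro hc
    obtain ⟨α, hα, -, rfl⟩ := mem_periods.1 hc
    rw [mem_OmegaJ_J0 hε] at hα
    have key : ∀ {i j k l : Fin 4} {t : ℝ}, (∀ x, coeff i j α x = t * coeff k l α x) →
        meanValue α ![e i, e j] = t * meanValue α ![e k, e l] := fun {i j k l t} h => by
      have h' : coeff i j α = t • coeff k l α := TorusField.ext h
      rw [← meanValue_coeff, h', map_smul, meanValue_coeff, smul_eq_mul]
    refine ⟨key fun x => (hα x).1, key fun x => (hα x).2.1, key fun x => (hα x).2.2.1, ?_⟩
    rw [← neg_mul]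
    exact key fun x => by rw [(hα x).2.2.2, neg_mul]
  · rintro ⟨h0, h1, h3, h5⟩
    have hco : coeffs (c 0 • dxWedge 0 1 + c 1 • dxWedge 2 3 + c 2 • dxWedge 0 2 +
        c 3 • dxWedge 1 3 + c 4 • dxWedge 0 3 + c 5 • dxWedge 1 2) = c := by
      ext i
      fin_cases i <;> simp [coeffs_apply, dxWedge_apply]
    refine mem_periods.2 ⟨_, (mem_OmegaJ_J0 hε).2 fun x => ?_, d_const _,
      (period_const _).trans hco⟩
    simpa [coeff_apply, dxWedge_apply] using ⟨h0, h1, h3, h5⟩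

theorem hMinus_J0 : hMinus J0 = 2 := by
  let L : (Fin 2 → ℝ) →ₗ[ℝ] Fin 6 → ℝ :=
    { toFun := fun v => ![0, 0, v 0, -v 0, v 1, v 1]
      map_add' := fun v w => by ext i; fin_cases i <;> simp [add_comm]
      map_smul' := fun t v => by ext i; fin_cases i <;> simp }
  have hL : Function.Injective L := fun v w h => by
    ext i
    fin_cases i
    · exact congrFun h 2
    · exact congrFun h 4
  have hr : periods (-1) J0 = LinearMap.range L := by
    ext c
    rw [mem_periods_J0 (by norm_num)]
    constructor
    · rintro ⟨h0, h1, h3, h5⟩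
      refine ⟨![c 2, c 4], ?_⟩
      ext i
      fin_cases i <;> simp [L] <;> linarith
    · rintro ⟨v, rfl⟩
      simp [L]
  rw [hMinus, rank_HJ, hr, rank_range_of_injective L hL, rank_fin_fun]
  rfl

theorem hPlus_J0 : hPlus J0 = 4 := by
  let L : (Fin 4 → ℝ) →ₗ[ℝ] Fin 6 → ℝ :=
    { toFun := fun v => ![v 0, v 1, v 2, v 2, v 3, -v 3]
      map_add' := fun v w => by ext i; fin_cases i <;> simp [add_comm]
      map_smul' := fun t v => by ext i; fin_cases i <;> simp }
  have hL : Function.Injective L := fun v w h => by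
    ext i
    fin_cases i
    · exact congrFun h 0
    · exact congrFun h 1
    · exact congrFun h 2
    · exact congrFun h 4
  have hr : periods 1 J0 = LinearMap.range L := by
    ext c
    rw [mem_periods_J0 (by norm_num)]
    constructor
    · rintro ⟨h0, h1, h3, h5⟩
      refine ⟨![c 0, c 1, c 2, c 4], ?_⟩
      ext i
      fin_cases i <;> simp [L] <;> linarith
    · rintro ⟨v, rfl⟩
      simp [L]
  rw [hPlus, rank_HJ, hr, rank_range_of_injective L hL, rank_fin_fun]
  rfl

end Torus4

end

open Torus4
theorem mainTheorem2 :
    -- `(g₀, J₀, ω₀)` is the standard flat Kähler structure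
    (d 2 omega0 = 0 ∧ IsCompatible omega0 J0 ∧ g0 = metricOf omega0 J0 ∧
      ∀ x, coAct J0 x (dx 0) = dx 1 ∧ coAct J0 x (dx 1) = -dx 0 ∧
        coAct J0 x (dx 2) = dx 3 ∧ coAct J0 x (dx 3) = -dx 2) ∧
    -- the almost Kähler structures `(g_k, J_k, ω₀)`
    (∀ k : ℕ, 1 ≤ k → IsCompatible omega0 (J k) ∧
      ∀ x, coAct (J k) x (dx 0) = C k x • dx 1 ∧ coAct (J k) x (dx 1) = -(1 / C k x) • dx 0 ∧
        coAct (J k) x (dx 2) = D k x • dx 3 ∧ coAct (J k) x (dx 3) = -(1 / D k x) • dx 2) ∧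
    -- convergence in the `C^∞` topology
    Tendsto J atTop (𝓝 J0) ∧ Tendsto g atTop (𝓝 g0) ∧
    -- the dimensions
    (∀ k : ℕ, 1 ≤ k → hMinus (J k) = 0 ∧ hPlus (J k) = 6) ∧
    hMinus J0 = 2 ∧ hPlus J0 = 4 ∧
    -- `h^-` is not constant along deformations of `J₀` through `ω₀`-compatible structures
    ∃ J' : AlmostComplex,
      JoinedIn {J : AlmostComplex | IsCompatible omega0 J} J0 J' ∧ hMinus J' ≠ hMinus J0 := by
  have hk : ∀ k : ℕ, 1 ≤ k → (1 / k : ℝ) ≠ 0 := fun k h =>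
    one_div_ne_zero (Nat.cast_ne_zero.2 (Nat.one_le_iff_ne_zero.1 h))
  refine ⟨⟨d_const _, family_zero ▸ isCompatible_family 0, g0_eq, fun x => ?_⟩,
    fun k _ => ⟨J_eq_family k ▸ isCompatible_family _, fun x => coAct_blockEnd rfl⟩,
    ?_, ?_, fun k h => ?_, hMinus_J0, hPlus_J0, family 1, ?_, ?_⟩
  · obtain ⟨h0, h1, h2, h3⟩ := coAct_blockEnd (J := J0) (c := 1) (d := 1) (x := x) rfl
    rw [h0, h1, h2, h3]
    refine ⟨?_, ?_, ?_, ?_⟩ <;> ext1 u <;> simp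
  -- As the J_k are the values of a continuous path at 1/k, convergence is continuity at 0.
  · rw [funext J_eq_family, ← family_zero]
    exact (continuous_family.tendsto 0).comp tendsto_one_div_atTop_nhds_zero_nat
  · rw [g0_eq, ← family_zero, show g = fun k : ℕ => metricOf omega0 (family (1 / k)) from
      funext fun k => by rw [← J_eq_family]; rfl]
    exact (continuous_metricOf_family.tendsto 0).comp tendsto_one_div_atTop_nhds_zero_nat
  · rw [J_eq_family]
    exact ⟨hMinus_family (hk k h), hPlus_family (hk k h)⟩
  -- The witness is the endpoint s = 1 of the same path, that is J₁.
  · exact ⟨⟨⟨fun t => family t, continuous_family.comp continuous_subtype_val⟩,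
      family_zero, rfl⟩, fun t => isCompatible_family t⟩
  · rw [hMinus_family one_ne_zero, hMinus_J0]
    exact two_ne_zero.symm
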